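/- Consider $J$ miners, $\mathcal J=\{1,\dots,J\}$, with a minimum investment coefficient $0<\tau_0\le 1$, a block reward $\Phi+\rho\Psi$ (fixed reward $\Phi\ge 0$, reward per transaction $\rho\ge 0$, number of transactions $\Psi\ge0$), and for each miner $j$ a unit cost $c_j\ge 0$, an estimate $\hat x_j\in\mathbb R$ of its computing resources, and numbers $\mu_j\in\mathbb R$, $\sigma_j\ge 0$ with $\hat x_j+\mu_j>0$. If the resource uncertainties take the values $\Delta\bm x=(\Delta x_1,\dots,\Delta x_J)$, so that the available resources are $x_k=\hat x_k+\Delta x_k$, the utility of miner $j$ at the investment profile $\bm\alpha\in[\tau_0,1]^J$ is $$U_j(\bm\alpha,\Delta\bm x)=(\Phi+\rho\Psi)\frac{\alpha_jx_j}{\sum_{k\in\mathcal J}\alpha_kx_k}-c_j\alpha_jx_j .$$ The ambiguity set $\mathcal P_j$ consists of all probability laws of $\Delta x_j$ on $\mathbb R$ with mean $\mu_j$ and variance $\sigma_j^2$ under which $x_j=\hat x_j+\Delta x_j>0$ almost surely. In the distributionally robust mining game $\mathcal G$, each miner $j$ chooses $\alpha_j\in[\tau_0,1]$ and receives the worst-case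 expected utility $$\inf_{\mathbb P_j\in\mathcal P_j}\ \mathbb E_{\Delta x_j\sim\mathbb P_j}\,U_j(\alpha_j,\bm\alpha_{-j},\Delta\bm x),$$ where the uncertainties $\Delta x_l$, $l\ne j$, of its rivals are given: either fixed numbers with $\hat x_l+\Delta x_l>0$ or, more generally, the coordinates $l\neq j$ of a random vector in $\mathbb R^J$ that is independent of $\Delta x_j$ and has a given law $Q$ (the same $Q$ for all miners) with $\hat x_k+d_k>0$ for all $k\in\mathcal J$, for $Q$-almost every $d\in\mathbb R^J$; in that case the expectation is taken over them as well. **Theorem.** For all such data, the game $\mathcal G$ has a Nash equilibrium: there is $\bm\alpha^*\in[\tau_0,1]^J$ such that, for every $j\in\mathcal J$, $$\alpha_j^*\in\arg\max_{\alpha_j\in[\tau_0,1]}\ \inf_{\mathbb P_j\in\mathcal P_j}\ \mathbb E_{\Delta x_j\sim\mathbb P_j}\,U_j(\alpha_j,\bm\alpha^*_{-j},\Delta\bm x).$$ -/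

import Mathlib

open MeasureTheory Set

noncomputable section

/-- Parameters of a proof-of-work mining network with `J` miners. -/
structure MiningNetwork (J : ℕ) where
  /-- minimum admissible investment coefficient -/
  τ₀ : ℝ
  /-- fixed block reward -/
  Φ : ℝ
  /-- reward per transaction -/
  ρ : ℝ
  /-- number of transactions -/
  Ψ : ℝ
  /-- cost per unit of resource -/
  c : Fin J → ℝ
  /-- estimated available resources -/
  xhat : Fin J → ℝ
  /-- mean of the resource uncertainty -/
  μ : Fin J → ℝ
  /-- standard deviation of the resource uncertainty -/
  σ : Fin J → ℝ
  τ₀_pos : 0 < τ₀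
  τ₀_le_one : τ₀ ≤ 1
  Φ_nonneg : 0 ≤ Φ
  ρ_nonneg : 0 ≤ ρ
  Ψ_nonneg : 0 ≤ Ψ
  c_nonneg : ∀ j, 0 ≤ c j
  σ_nonneg : ∀ j, 0 ≤ σ j
  /-- the mean of the available resources is positive -/
  mean_pos : ∀ j, 0 < xhat j + μ j

namespace MiningNetwork

variable {J : ℕ} (N : MiningNetwork J)

/-- Actual available resources of miner `j` when the uncertainties take the values `d`. -/
def resource (d : Fin J → ℝ) (j : Fin J) : ℝ := N.xhat j + d j

/-- Share of miner `j` in the total hashing power. -/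
def share (j : Fin J) (α d : Fin J → ℝ) : ℝ :=
  α j * N.resource d j / ∑ k, α k * N.resource d k

/-- Utility of miner `j` at the profile `α` when the uncertainties take the values `d`. -/
def utility (j : Fin J) (α d : Fin J → ℝ) : ℝ :=
  (N.Φ + N.ρ * N.Ψ) * N.share j α d - N.c j * α j * N.resource d j

/-- Strategy space of each miner. -/
def strategies : Set ℝ := Icc N.τ₀ 1

/-- Ambiguity set of miner `j`: all laws of its resource uncertainty with mean `μ j` and variance
`σ j ^ 2` under which the available resources are positive. -/
def ambiguitySet (j : Fin J) : Set (Measure ℝ) :=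
  {P | IsProbabilityMeasure P ∧ MemLp (fun ξ : ℝ => ξ) 2 P ∧ (∀ᵐ ξ ∂P, 0 < N.xhat j + ξ) ∧
    ∫ ξ, ξ ∂P = N.μ j ∧ ∫ ξ, (ξ - N.μ j) ^ 2 ∂P = N.σ j ^ 2}

/-- Admissible laws of the vector of the uncertainties met by the rivals of a miner. A point mass
at `d` describes rivals whose uncertainties take the values `d`. -/
def IsRivalLaw (Q : Measure (Fin J → ℝ)) : Prop :=
  IsProbabilityMeasure Q ∧ ∀ᵐ d ∂Q, ∀ l, 0 < N.resource d l

/-- Expected utility of miner `j` when its own uncertainty `ξ` has law `P` and, independently, the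
uncertainties of its rivals are the coordinates `d l`, `l ≠ j`, of `d` with law `Q`. -/
def expectedUtility (Q : Measure (Fin J → ℝ)) (j : Fin J) (P : Measure ℝ) (α : Fin J → ℝ) : ℝ :=
  ∫ z : (Fin J → ℝ) × ℝ, N.utility j α (Function.update z.1 j z.2) ∂(Q.prod P)

/-- Payoff of miner `j` in the distributionally robust mining game: its worst-case expected
utility over its ambiguity set. -/
def robustUtility (Q : Measure (Fin J → ℝ)) (j : Fin J) (α : Fin J → ℝ) : ℝ :=
  ⨅ P : N.ambiguitySet j, N.expectedUtility Q j P α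

/-- Nash equilibrium of the distributionally robust mining game: each miner's coefficient
maximizes its worst-case expected utility over its strategy space, given those of its rivals. -/
def IsRobustNashEquilibrium (Q : Measure (Fin J → ℝ)) (α : Fin J → ℝ) : Prop :=
  ∀ j, α j ∈ N.strategies ∧
    IsMaxOn (fun a => N.robustUtility Q j (Function.update α j a)) N.strategies (α j)

/-- The ambiguity sets are nonempty: they contain a two-point law. -/
theorem ambiguitySet_nonempty (j : Fin J) : (N.ambiguitySet j).Nonempty := by
  have hm := N.mean_pos j
  set s := N.σ j
  set m := N.μ j
  set δ := (N.xhat j + m) / 2 with hδ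
  have hδp : 0 < δ := by positivity
  have hD : 0 < δ ^ 2 + s ^ 2 := by positivity
  set p : ℝ := δ ^ 2 / (δ ^ 2 + s ^ 2) with hp
  set q : ℝ := s ^ 2 / (δ ^ 2 + s ^ 2) with hq
  have hp0 : 0 ≤ p := by positivity
  have hq0 : 0 ≤ q := by positivity
  have hpq : p + q = 1 := by rw [hp, hq]; field_simp
  let P : Measure ℝ := ENNReal.ofReal p • Measure.dirac (m + s ^ 2 / δ) +
    ENNReal.ofReal q • Measure.dirac (m - δ)
  have hint : ∀ f : ℝ → ℝ, Measurable f → Integrable f P := fun f hf => by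
    refine Integrable.add_measure ?_ ?_
    · exact (integrable_dirac (by simp)).smul_measure ENNReal.ofReal_ne_top
    · exact (integrable_dirac (by simp)).smul_measure ENNReal.ofReal_ne_top
  have hval : ∀ f : ℝ → ℝ, Measurable f →
      ∫ ξ, f ξ ∂P = p * f (m + s ^ 2 / δ) + q * f (m - δ) := fun f hf => by
    rw [integral_add_measure, integral_smul_measure, integral_smul_measure, integral_dirac,
      integral_dirac, ENNReal.toReal_ofReal hp0, ENNReal.toReal_ofReal hq0]
    · simp
    · exact (integrable_dirac (by simp)).smul_measure ENNReal.ofReal_ne_top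
    · exact (integrable_dirac (by simp)).smul_measure ENNReal.ofReal_ne_top
  refine ⟨P, ⟨?_⟩, ?_, ?_, ?_, ?_⟩
  · simp [P, ← ENNReal.ofReal_add hp0 hq0, hpq]
  · exact (memLp_two_iff_integrable_sq measurable_id.aestronglyMeasurable).2
      (hint _ (by fun_prop))
  · have hs : 0 ≤ s ^ 2 / δ := by positivity
    refine ae_add_measure_iff.2 ⟨?_, ?_⟩
    · refine Measure.ae_smul_measure ?_ _
      rw [ae_dirac_iff (measurableSet_lt measurable_const (by fun_prop))]
      linarith
    · refine Measure.ae_smul_measure ?_ _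
      rw [ae_dirac_iff (measurableSet_lt measurable_const (by fun_prop))]
      linarith
  · rw [hval _ (by fun_prop), hp, hq]
    field_simp
    ring
  · rw [hval _ (by fun_prop), hp, hq]
    field_simp
    ring

/-- Under admissible laws the resources of all miners are almost surely positive. -/
theorem ae_resource_pos {Q : Measure (Fin J → ℝ)} (hQ : N.IsRivalLaw Q) {j : Fin J}
    {P : Measure ℝ} (hP : P ∈ N.ambiguitySet j) :
    ∀ᵐ z ∂(Q.prod P), ∀ k, 0 < N.resource (Function.update z.1 j z.2) k := by
  have := hQ.1
  have := hP.1
  have h1 : ∀ᵐ z ∂(Q.prod P), ∀ l, 0 < N.resource z.1 l :=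
    Measure.quasiMeasurePreserving_fst.ae hQ.2
  have h2 : ∀ᵐ z ∂(Q.prod P), 0 < N.xhat j + z.2 :=
    Measure.quasiMeasurePreserving_snd.ae hP.2.2.1
  filter_upwards [h1, h2] with z hz1 hz2 k
  by_cases hk : k = j
  · subst hk
    simpa [resource] using hz2
  · simpa [resource, Function.update_of_ne hk] using hz1 k

/-- The expectations that define the game exist. -/
theorem integrable_utility {Q : Measure (Fin J → ℝ)} (hQ : N.IsRivalLaw Q) {j : Fin J}
    {P : Measure ℝ} (hP : P ∈ N.ambiguitySet j) {α : Fin J → ℝ} (hα : ∀ k, α k ∈ N.strategies) :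
    Integrable (fun z : (Fin J → ℝ) × ℝ => N.utility j α (Function.update z.1 j z.2))
      (Q.prod P) := by
  have := hQ.1
  have := hP.1
  have hm : ∀ k, Measurable fun z : (Fin J → ℝ) × ℝ =>
      N.resource (Function.update z.1 j z.2) k := fun k => by
    by_cases hk : k = j
    · subst hk
      simp only [resource, Function.update_self]
      fun_prop
    · simp only [resource, Function.update_of_ne hk]
      fun_prop
  have hpos : ∀ k, 0 < α k := fun k => N.τ₀_pos.trans_le (hα k).1
  have hshare : Integrable (fun z : (Fin J → ℝ) × ℝ =>
      N.share j α (Function.update z.1 j z.2)) (Q.prod P) := by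
    refine Integrable.of_bound (C := 1) ?_ ?_
    · refine Measurable.aestronglyMeasurable ?_
      unfold share
      exact ((hm j).const_mul _).div
        (Finset.measurable_sum _ fun k _ => (hm k).const_mul _)
    · filter_upwards [N.ae_resource_pos hQ hP] with z hz
      have hnn : ∀ k, 0 ≤ α k * N.resource (Function.update z.1 j z.2) k :=
        fun k => (mul_pos (hpos k) (hz k)).le
      unfold share
      rw [Real.norm_of_nonneg (div_nonneg (hnn j) (Finset.sum_nonneg fun k _ => hnn k))]
      exact div_le_one_of_le₀ (Finset.single_le_sum (fun k _ => hnn k) (Finset.mem_univ j))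
        (Finset.sum_nonneg fun k _ => hnn k)
  have hres : Integrable (fun z : (Fin J → ℝ) × ℝ =>
      N.resource (Function.update z.1 j z.2) j) (Q.prod P) := by
    simp only [resource, Function.update_self]
    have : Integrable (fun ξ : ℝ => ξ) P := hP.2.1.integrable one_le_two
    exact (integrable_const _).add (this.comp_snd Q)
  exact (hshare.const_mul _).sub (hres.const_mul _)

/-- The infimum that defines the worst-case expected utility is taken over a set that is bounded
below. -/
theorem bddBelow_expectedUtility {Q : Measure (Fin J → ℝ)} (hQ : N.IsRivalLaw Q) (j : Fin J)
    {α : Fin J → ℝ} (hα : ∀ k, α k ∈ N.strategies) :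
    BddBelow (range fun P : N.ambiguitySet j => N.expectedUtility Q j P α) := by
  have := hQ.1
  refine ⟨-(N.c j * α j * (N.xhat j + N.μ j)), ?_⟩
  rintro _ ⟨⟨P, hP⟩, rfl⟩
  have := hP.1
  have hid : Integrable (fun ξ : ℝ => ξ) P := hP.2.1.integrable one_le_two
  have hpos : ∀ k, 0 < α k := fun k => N.τ₀_pos.trans_le (hα k).1
  have hres : Integrable (fun z : (Fin J → ℝ) × ℝ =>
      -(N.c j * α j * (N.xhat j + z.2))) (Q.prod P) :=
    (((integrable_const _).add (hid.comp_snd Q)).const_mul _).neg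
  have hval : ∫ z : (Fin J → ℝ) × ℝ, -(N.c j * α j * (N.xhat j + z.2)) ∂(Q.prod P) =
      -(N.c j * α j * (N.xhat j + N.μ j)) := by
    rw [integral_fun_snd (μ := Q) (fun ξ : ℝ => -(N.c j * α j * (N.xhat j + ξ))), integral_neg,
      integral_const_mul, integral_add (integrable_const _) hid, hP.2.2.2.1]
    simp
  rw [← hval]
  refine integral_mono_ae hres (N.integrable_utility hQ hP hα) ?_
  filter_upwards [N.ae_resource_pos hQ hP] with z hz
  have hnn : ∀ k, 0 ≤ α k * N.resource (Function.update z.1 j z.2) k :=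
    fun k => (mul_pos (hpos k) (hz k)).le
  have hs : 0 ≤ N.share j α (Function.update z.1 j z.2) :=
    div_nonneg (hnn j) (Finset.sum_nonneg fun k _ => hnn k)
  have hR : 0 ≤ N.Φ + N.ρ * N.Ψ :=
    add_nonneg N.Φ_nonneg (mul_nonneg N.ρ_nonneg N.Ψ_nonneg)
  have hj : N.resource (Function.update z.1 j z.2) j = N.xhat j + z.2 := by simp [resource]
  have hRs := mul_nonneg hR hs
  simp only [utility, hj]
  linarith

end MiningNetwork

end

/-! A miner's share has the form `t * x / (t * x + y)` in its own coefficient `t`, hence is concave,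
and its cost is linear. Expectations preserve concavity, and so does the infimum over the ambiguity
set. The share is moreover Lipschitz in the profile, uniformly in the resources, because
coefficients are at least `τ₀`; the Lipschitz constant of the cost is linear in the miner's own
resource, whose mean is the same under every admissible law. So all expected utilities share one
Lipschitz constant, and their infimum is continuous (`continuousOn_robustUtility`,
`concaveOn_robustUtility`).

Strategies are numbers, so an equilibrium can be found without a fixed-point theorem for
correspondences. Let `A j` be the profiles where `j` gains nothing by decreasing its choice, `B j`
those where it gains nothing by increasing it. By quasiconcavity these closed sets cover the box,
and a point common to all of them is an equilibrium.

Such a point comes from a Poincaré–Miranda theorem, proved on finer and finer grids. Modulo two, the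
cup product of the differences of the colourings, summed over the grid, equals 1 by a discrete
Stokes argument, so some cube carries a nonzero value, and on it every colouring changes. -/

/-! ### Cup products of differences on a grid -/

section Grid

variable {ι : Type*} [DecidableEq ι]

/-- The neighbour of the grid point `v` in direction `k`. -/
def gridStep (v : ι → ℕ) (k : ι) : ι → ℕ := Function.update v k (v k + 1)

theorem gridStep_comm (v : ι → ℕ) (k l : ι) :
    gridStep (gridStep v k) l = gridStep (gridStep v l) k := by
  by_cases h : k = l
  · rw [h]
  · ext i
    by_cases hi : i = k <;> by_cases hj : i = l <;> simp_all [gridStep, Function.update_apply]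

/-- The value modulo two, on the cube with base `v` and directions `I`, of the cup product of the
differences of the functions `f j`, `j ∈ js`. -/
def cupDiff (f : ι → (ι → ℕ) → ZMod 2) : List ι → (ι → ℕ) → Finset ι → ZMod 2
  | [], _, _ => 1
  | j :: js, v, I =>
    ∑ k ∈ I, (f j (gridStep v k) - f j v) * cupDiff f js (gridStep v k) (I.erase k)

/-- The terms at `(k, l)` and `(l, k)` cancel in characteristic two. -/
theorem sum_sum_erase_eq_zero_of_symm (I : Finset ι) (g : ι → ι → ZMod 2)
    (hg : ∀ k l, g k l = g l k) : ∑ k ∈ I, ∑ l ∈ I.erase k, g k l = 0 := by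
  rw [Finset.sum_sigma']
  refine Finset.sum_involution (fun x _ => ⟨x.2, x.1⟩) ?_ ?_ ?_ ?_
  · rintro ⟨k, l⟩ -
    simp only [hg l k]
    exact CharTwo.add_self_eq_zero _
  · rintro ⟨k, l⟩ h - he
    simp at h he
    grind
  · rintro ⟨k, l⟩ h
    simp at h ⊢
    grind
  · rintro ⟨k, l⟩ h
    rfl

theorem sum_erase_comm (I : Finset ι) (g : ι → ι → ZMod 2) :
    ∑ k ∈ I, ∑ l ∈ I.erase k, g k l = ∑ k ∈ I, ∑ l ∈ I.erase k, g l k := by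
  refine Finset.sum_comm' fun k l => ?_
  simp only [Finset.mem_erase]
  grind

/-- Cup products of differences are closed. -/
theorem sum_cupDiff_gridStep (f : ι → (ι → ℕ) → ZMod 2) (js : List ι) (v : ι → ℕ)
    (I : Finset ι) :
    ∑ k ∈ I, cupDiff f js (gridStep v k) (I.erase k) = ∑ k ∈ I, cupDiff f js v (I.erase k) := by
  induction js generalizing v I with
  | nil => simp [cupDiff]
  | cons j js ih =>
    -- Each side expands into two double sums. One on each side is symmetric and vanishes (`h1`,
    -- `h3`); the other two agree (`h2`) up to a sign, immaterial modulo two.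
    have h1 : ∑ k ∈ I, ∑ l ∈ I.erase k, f j (gridStep (gridStep v k) l) *
        cupDiff f js (gridStep (gridStep v k) l) ((I.erase k).erase l) = 0 :=
      sum_sum_erase_eq_zero_of_symm I _ fun k l => by
        rw [gridStep_comm, Finset.erase_right_comm]
    have h2 : ∑ k ∈ I, ∑ l ∈ I.erase k, f j (gridStep v k) *
        cupDiff f js (gridStep (gridStep v k) l) ((I.erase k).erase l) =
        ∑ k ∈ I, ∑ l ∈ I.erase k, f j (gridStep v l) *
        cupDiff f js (gridStep v l) ((I.erase k).erase l) := by
      rw [sum_erase_comm I fun k l => f j (gridStep v l) *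
        cupDiff f js (gridStep v l) ((I.erase k).erase l)]
      refine Finset.sum_congr rfl fun k _ => ?_
      rw [← Finset.mul_sum, ih, Finset.mul_sum]
      refine Finset.sum_congr rfl fun l _ => ?_
      rw [Finset.erase_right_comm]
    have h3 : ∑ k ∈ I, ∑ l ∈ I.erase k, f j v *
        cupDiff f js (gridStep v l) ((I.erase k).erase l) = 0 := by
      simp only [← Finset.mul_sum, ih]
      rw [sum_sum_erase_eq_zero_of_symm I _ fun k l => by rw [Finset.erase_right_comm], mul_zero]
    simp only [cupDiff, sub_mul, Finset.sum_sub_distrib]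
    rw [h1, h2, h3]
    simp

/-- The cube lies in a hyperplane on which `f k` is constant, so every product contains a zero
difference of `f k`. -/
theorem cupDiff_eq_zero (f : ι → (ι → ℕ) → ZMod 2) {k : ι} {m : ℕ} {b : ZMod 2}
    (hf : ∀ w, w k = m → f k w = b) (js : List ι) (hk : k ∈ js) (v : ι → ℕ) (hv : v k = m)
    (I : Finset ι) (hI : k ∉ I) : cupDiff f js v I = 0 := by
  induction js generalizing v I with
  | nil => simp at hk
  | cons j js ih =>
    rw [cupDiff]
    refine Finset.sum_eq_zero fun l hl => ?_
    have hlk : k ≠ l := fun h => hI (h ▸ hl)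
    have hv' : gridStep v l k = m := by rw [gridStep, Function.update_of_ne hlk, hv]
    rcases List.mem_cons.1 hk with rfl | hk'
    · rw [hf _ hv', hf _ hv, sub_self, zero_mul]
    · rw [ih hk' _ hv' _ (by simp [hI]), mul_zero]

/-- Unfolded, `cupDiff` sums over monotone edge paths in the cube, with one factor per edge. A
nonzero summand has a nonzero factor for every `j`, that is, an edge on which `f j` changes. -/
theorem exists_ne_of_cupDiff_ne_zero (f : ι → (ι → ℕ) → ZMod 2) (js : List ι) (v : ι → ℕ)
    (I : Finset ι) (h : cupDiff f js v I ≠ 0) (j : ι) (hj : j ∈ js) :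
    ∃ w w' : ι → ℕ, f j w ≠ f j w' ∧
      ∀ i, (v i ≤ w i ∧ w i ≤ v i + if i ∈ I then 1 else 0) ∧
        (v i ≤ w' i ∧ w' i ≤ v i + if i ∈ I then 1 else 0) := by
  induction js generalizing v I with
  | nil => simp at hj
  | cons l js ih =>
    rw [cupDiff] at h
    obtain ⟨k, hk, hne⟩ := Finset.exists_ne_zero_of_sum_ne_zero h
    rcases List.mem_cons.1 hj with rfl | hj'
    · refine ⟨gridStep v k, v, sub_ne_zero.1 (left_ne_zero_of_mul hne), fun i => ?_⟩
      by_cases hi : i = k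
      · subst hi
        simp [gridStep, hk]
      · simp [gridStep, Function.update_of_ne hi]
    · obtain ⟨w, w', hw, hb⟩ := ih _ _ (right_ne_zero_of_mul hne) hj'
      refine ⟨w, w', hw, fun i => ?_⟩
      have := hb i
      by_cases hi : i = k
      · subst hi
        simp [gridStep, hk] at this ⊢
        omega
      · simpa [gridStep, Function.update_of_ne hi, hi] using this

variable [Fintype ι]

/-- The base points of the cubes with directions `I` in the face of the grid where all other
coordinates vanish. -/
def gridBox (n : ℕ) (I : Finset ι) : Finset (ι → ℕ) :=
  Fintype.piFinset fun k => if k ∈ I then Finset.range n else {0}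

theorem sum_gridBox_telescope (n : ℕ) (I : Finset ι) {k : ι} (hk : k ∈ I)
    (h : (ι → ℕ) → ZMod 2) :
    ∑ v ∈ gridBox n I, (h (gridStep v k) - h v) =
      ∑ v ∈ gridBox n (I.erase k), (h (Function.update v k n) - h v) := by
  have key : ∑ v ∈ gridBox n I, (h (gridStep v k) - h v) =
      ∑ p ∈ gridBox n (I.erase k) ×ˢ Finset.range n,
        (h (Function.update p.1 k (p.2 + 1)) - h (Function.update p.1 k p.2)) := by
    refine Finset.sum_bij' (fun v _ => (Function.update v k 0, v k))
      (fun p _ => Function.update p.1 k p.2) ?_ ?_ ?_ ?_ ?_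
    · intro v hv
      simp only [gridBox, Fintype.mem_piFinset, Finset.mem_product] at hv ⊢
      refine ⟨fun i => ?_, by simpa [hk] using hv k⟩
      by_cases hi : i = k
      · subst hi; simp
      · simpa [hi] using hv i
    · rintro ⟨v, m⟩ hv
      simp only [gridBox, Fintype.mem_piFinset, Finset.mem_product] at hv ⊢
      intro i
      by_cases hi : i = k
      · subst hi; simpa [hk] using hv.2
      · simpa [hi] using hv.1 i
    · intro v _
      simp
    · rintro ⟨v, m⟩ hv
      simp only [gridBox, Fintype.mem_piFinset, Finset.mem_product] at hv
      have := hv.1 k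
      simp at this
      simp [← this]
    · intro v _
      simp [gridStep]
  rw [key, Finset.sum_product]
  refine Finset.sum_congr rfl fun v hv => ?_
  rw [Finset.sum_range_sub fun m => h (Function.update v k m)]
  have : v k = 0 := by
    have := Fintype.mem_piFinset.1 hv k
    simpa using this
  rw [← this, Function.update_eq_self]

/-- Induction on dimension by Stokes: the cup product is the coboundary of `f j` times a closed
cochain, so its sum reduces to the faces of the grid. Only the face where coordinate `j` vanishes
contributes, and there `f j = 1` leaves the sum of one dimension less. -/
theorem sum_gridBox_cupDiff (f : ι → (ι → ℕ) → ZMod 2) {n : ℕ}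
    (h0 : ∀ j w, w j = 0 → f j w = 1) (hn : ∀ j w, w j = n → f j w = 0) (js : List ι)
    (hjs : js.Nodup) : ∑ v ∈ gridBox n js.toFinset, cupDiff f js v js.toFinset = 1 := by
  induction js with
  | nil => simp [cupDiff, gridBox]
  | cons j js ih =>
    obtain ⟨hj, hjs⟩ := List.nodup_cons.1 hjs
    set I := (j :: js).toFinset with hI
    have hjI : j ∈ I := by simp [hI]
    have herase : I.erase j = js.toFinset := by
      rw [hI, List.toFinset_cons, Finset.erase_insert (by simpa using hj)]
    -- Leibniz rule: closedness of the remaining product lets its base point move from `gridStep v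
    -- k` to `v` in the subtracted term.
    have h1 : ∀ v, cupDiff f (j :: js) v I = ∑ k ∈ I,
        (f j (gridStep v k) * cupDiff f js (gridStep v k) (I.erase k) -
          f j v * cupDiff f js v (I.erase k)) := fun v => by
      simp only [cupDiff, sub_mul, Finset.sum_sub_distrib]
      rw [← Finset.mul_sum, ← Finset.mul_sum, sum_cupDiff_gridStep]
    simp only [h1]
    rw [Finset.sum_comm, Finset.sum_eq_single_of_mem j hjI]
    · rw [sum_gridBox_telescope n I hjI fun w => f j w * cupDiff f js w (I.erase j), herase]
      rw [← CharTwo.neg_eq (1 : ZMod 2), ← ih hjs, ← Finset.sum_neg_distrib]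
      refine Finset.sum_congr rfl fun v hv => ?_
      have hv0 : v j = 0 := by
        have := Fintype.mem_piFinset.1 hv j
        simpa [hj] using this
      rw [hn j (Function.update v j n) (by simp), h0 j v hv0]
      simp
    -- On both faces orthogonal to another direction `k`, `f k` is constant and occurs in the
    -- remaining product.
    · intro k hk hkj
      have hkjs : k ∈ js := by simpa [hI, hkj] using hk
      rw [sum_gridBox_telescope n I hk fun w => f j w * cupDiff f js w (I.erase k)]
      refine Finset.sum_eq_zero fun v hv => ?_
      have hv0 : v k = 0 := by
        have := Fintype.mem_piFinset.1 hv k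
        simpa using this
      rw [cupDiff_eq_zero f (hn k) js hkjs _ (by simp) _ (by simp),
        cupDiff_eq_zero f (h0 k) js hkjs _ hv0 _ (by simp)]
      simp

/-- Discrete Poincaré–Miranda theorem: two-colourings of a grid, one for each direction, that
separate the opposite faces all change on a common unit cube. -/
theorem exists_cube_forall_both_colours (f : ι → (ι → ℕ) → ZMod 2) {n : ℕ}
    (h0 : ∀ j w, w j = 0 → f j w = 1) (hn : ∀ j w, w j = n → f j w = 0) :
    ∃ v : ι → ℕ, (∀ i, v i < n) ∧ ∀ j, ∃ w w' : ι → ℕ, f j w = 1 ∧ f j w' = 0 ∧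
      ∀ i, (v i ≤ w i ∧ w i ≤ v i + 1) ∧ (v i ≤ w' i ∧ w' i ≤ v i + 1) := by
  have hsum := sum_gridBox_cupDiff f h0 hn Finset.univ.toList (Finset.nodup_toList _)
  rw [Finset.toList_toFinset] at hsum
  obtain ⟨v, hv, hne⟩ := Finset.exists_ne_zero_of_sum_ne_zero (hsum.trans_ne one_ne_zero)
  refine ⟨v, fun i => by simpa using Fintype.mem_piFinset.1 hv i, fun j => ?_⟩
  obtain ⟨w, w', hw, hb⟩ := exists_ne_of_cupDiff_ne_zero f _ v _ hne j (by simp)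
  simp only [Finset.mem_univ, if_true] at hb
  have h01 : ∀ x : ZMod 2, x = 0 ∨ x = 1 := by decide
  rcases h01 (f j w) with h | h <;> rcases h01 (f j w') with h' | h'
  · exact absurd (h.trans h'.symm) hw
  · exact ⟨w', w, h', h, fun i => (hb i).symm⟩
  · exact ⟨w, w', h, h', hb⟩
  · exact absurd (h.trans h'.symm) hw

end Grid

/-! ### Closed coverings of a box and equilibria -/

section Box

open Filter Topology

variable {ι : Type*} [Fintype ι] [DecidableEq ι]

/-- Poincaré–Miranda theorem for closed coverings: if a box is covered, for each coordinate, by two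
closed sets that contain the lower and the upper face, then all these sets have a common point. -/
theorem exists_mem_inter_of_closed_cover {a b : ℝ} (hab : a ≤ b) (A B : ι → Set (ι → ℝ))
    (hA : ∀ j, IsClosed (A j)) (hB : ∀ j, IsClosed (B j))
    (hcov : ∀ j u, (∀ k, u k ∈ Icc a b) → u ∈ A j ∨ u ∈ B j)
    (hlow : ∀ j u, (∀ k, u k ∈ Icc a b) → u j = a → u ∈ A j)
    (hup : ∀ j u, (∀ k, u k ∈ Icc a b) → u j = b → u ∈ B j) :
    ∃ u : ι → ℝ, (∀ k, u k ∈ Icc a b) ∧ ∀ j, u ∈ A j ∧ u ∈ B j := by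
  classical
  have step : ∀ n : ℕ, ∃ u : ι → ℝ, (∀ k, u k ∈ Icc a b) ∧ ∀ j, ∃ y ∈ A j, ∃ z ∈ B j,
      dist y u ≤ (b - a) / (n + 1) ∧ dist z u ≤ (b - a) / (n + 1) := by
    intro n
    have hn : (0 : ℝ) < n + 1 := by positivity
    have hba : 0 ≤ b - a := sub_nonneg.2 hab
    let p : (ι → ℕ) → ι → ℝ := fun w k => a + (b - a) * w k / (n + 1)
    have hp : ∀ w, (∀ k, w k ≤ n + 1) → ∀ k, p w k ∈ Icc a b := by
      intro w hw k
      have h1 : (w k : ℝ) ≤ n + 1 := by exact_mod_cast hw k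
      refine ⟨le_add_of_nonneg_right (by positivity), ?_⟩
      have : (b - a) * w k / (n + 1) ≤ b - a := by
        rw [div_le_iff₀ hn]
        gcongr
      simp only [p]
      linarith
    have hdist : ∀ v w : ι → ℕ, (∀ i, v i ≤ w i ∧ w i ≤ v i + 1) →
        dist (p w) (p v) ≤ (b - a) / (n + 1) := by
      intro v w hvw
      refine (dist_pi_le_iff (by positivity)).2 fun i => ?_
      have h1 : (v i : ℝ) ≤ w i := by exact_mod_cast (hvw i).1
      have h2 : (w i : ℝ) ≤ v i + 1 := by exact_mod_cast (hvw i).2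
      have h3 : p w i - p v i = (b - a) / (n + 1) * (w i - v i) := by
        simp only [p]; ring
      rw [Real.dist_eq, h3, abs_of_nonneg (mul_nonneg (by positivity) (by linarith))]
      exact mul_le_of_le_one_right (by positivity) (by linarith)
    -- Face colours are prescribed by grid index, since a point of the upper face may also lie in `A
    -- j`; this also covers `a = b`.
    let f : ι → (ι → ℕ) → ZMod 2 := fun j w =>
      if w j = 0 then 1 else if w j = n + 1 then 0 else if p w ∈ A j then 1 else 0
    obtain ⟨v, hv, h⟩ := exists_cube_forall_both_colours f (n := n + 1)
      (fun j w hw => by simp [f, hw]) (fun j w hw => by simp [f, hw])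
    refine ⟨p v, hp v fun k => (hv k).le, fun j => ?_⟩
    obtain ⟨w, w', hw, hw', hb⟩ := h j
    have hpw := hp w fun k => by have := hv k; have := (hb k).1.2; omega
    have hpw' := hp w' fun k => by have := hv k; have := (hb k).2.2; omega
    refine ⟨p w, ?_, p w', ?_, hdist v w fun i => (hb i).1, hdist v w' fun i => (hb i).2⟩
    · simp only [f] at hw
      split_ifs at hw with h1 h2 h3
      · exact hlow j _ hpw (by simp [p, h1])
      · simp at hw
      · exact h3
      · simp at hw
    · simp only [f] at hw'
      split_ifs at hw' with h1 h2 h3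
      · simp at hw'
      · refine hup j _ hpw' ?_
        simp only [p, h2]
        push_cast
        field_simp
        ring
      · simp at hw'
      · exact (hcov j _ hpw').resolve_left h3
  choose u hu y hy z hz hyu hzu using step
  have hcomp : IsCompact (Set.pi univ fun _ : ι => Icc a b) :=
    isCompact_univ_pi fun _ => isCompact_Icc
  obtain ⟨x, hx, φ, hφ, hlim⟩ := hcomp.tendsto_subseq fun n => mem_univ_pi.2 (hu n)
  have hzero : Tendsto (fun n => (b - a) / ((φ n : ℝ) + 1)) atTop (𝓝 0) := by
    have : Tendsto (fun n : ℕ => (b - a) / ((n : ℝ) + 1)) atTop (𝓝 0) :=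
      tendsto_const_nhds.div_atTop
        (tendsto_natCast_atTop_atTop.atTop_add tendsto_const_nhds)
    exact this.comp hφ.tendsto_atTop
  have hlim' : ∀ s : ℕ → ι → ℝ, (∀ n, dist (s n) (u n) ≤ (b - a) / (n + 1)) →
      Tendsto (fun n => s (φ n)) atTop (𝓝 x) := fun s hs => by
    refine hlim.congr_dist (squeeze_zero (fun _ => dist_nonneg) (fun n => ?_) hzero)
    rw [dist_comm]
    exact hs (φ n)
  refine ⟨x, mem_univ_pi.1 hx, fun j => ⟨?_, ?_⟩⟩
  · exact (hA j).mem_of_tendsto (hlim' (fun n => y n j) fun n => hyu n j)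
      (Eventually.of_forall fun n => hy (φ n) j)
  · exact (hB j).mem_of_tendsto (hlim' (fun n => z n j) fun n => hzu n j)
      (Eventually.of_forall fun n => hz (φ n) j)

/-- Existence of Nash equilibria: players choose numbers in a common compact interval, and payoffs
are continuous and quasiconcave in the player's own choice. -/
theorem exists_nash_equilibrium_of_quasiconcaveOn {a b : ℝ} (hab : a ≤ b) (V : ι → (ι → ℝ) → ℝ)
    (hcont : ∀ j, ContinuousOn (V j) (Set.pi univ fun _ => Icc a b))
    (hconc : ∀ j u, (∀ k, u k ∈ Icc a b) →
      QuasiconcaveOn ℝ (Icc a b) fun t => V j (Function.update u j t)) :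
    ∃ u : ι → ℝ, ∀ j, u j ∈ Icc a b ∧
      IsMaxOn (fun t => V j (Function.update u j t)) (Icc a b) (u j) := by
  set K : Set (ι → ℝ) := Set.pi univ fun _ => Icc a b with hK
  have hKc : IsClosed K := isClosed_set_pi fun _ _ => isClosed_Icc
  have hupd : ∀ j, ∀ t ∈ Icc a b, ∀ u ∈ K, Function.update u j t ∈ K := by
    intro j t ht u hu
    refine mem_univ_pi.2 fun k => ?_
    by_cases hk : k = j
    · subst hk; simpa using ht
    · simpa [Function.update_of_ne hk] using mem_univ_pi.1 hu k
  have himp : ∀ j, ∀ t ∈ Icc a b, IsClosed {u ∈ K | V j (Function.update u j t) ≤ V j u} :=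
    fun j t ht => hKc.isClosed_le
      ((hcont j).comp (by fun_prop) fun u hu => hupd j t ht u hu) (hcont j)
  -- The first family excludes profitable decreases of `u j`, the second profitable increases.
  obtain ⟨u, hu, h⟩ := exists_mem_inter_of_closed_cover hab
    (fun j => K ∩ ⋂ t ∈ Icc a b, ({u | u j ≤ t} ∪ {u ∈ K | V j (Function.update u j t) ≤ V j u}))
    (fun j => K ∩ ⋂ t ∈ Icc a b, ({u | t ≤ u j} ∪ {u ∈ K | V j (Function.update u j t) ≤ V j u}))
    (fun j => hKc.inter <| isClosed_biInter fun t ht =>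
      (isClosed_le (by fun_prop) (by fun_prop)).union (himp j t ht))
    (fun j => hKc.inter <| isClosed_biInter fun t ht =>
      (isClosed_le (by fun_prop) (by fun_prop)).union (himp j t ht))
    (fun j u hu => by
      have huK : u ∈ K := mem_univ_pi.2 hu
      by_contra! hcon
      simp only [mem_inter_iff, huK, true_and, mem_iInter, mem_union, mem_ofPred_eq] at hcon
      push Not at hcon
      obtain ⟨⟨s, hs, hsu, hVs⟩, t, ht, htu, hVt⟩ := hcon
      -- Better choices `s < u j < t` would put `u j` between two points of a superlevel set whose
      -- level exceeds its own payoff.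
      have hmem := ((hconc j u hu) (min (V j (Function.update u j s))
        (V j (Function.update u j t)))).ordConnected.out
        ⟨hs, min_le_left _ _⟩ ⟨ht, min_le_right _ _⟩ ⟨hsu.le, htu.le⟩
      have := hmem.2
      simp only [Function.update_eq_self] at this
      exact absurd this (not_le.2 (lt_min hVs hVt)))
    (fun j u hu hj => ⟨mem_univ_pi.2 hu, mem_iInter₂.2 fun t ht => Or.inl (hj.trans_le ht.1)⟩)
    (fun j u hu hj => ⟨mem_univ_pi.2 hu, mem_iInter₂.2 fun t ht => Or.inl (ht.2.trans_eq hj.symm)⟩)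
  refine ⟨u, fun j => ⟨hu j, fun t ht => ?_⟩⟩
  simp only [mem_ofPred_eq, Function.update_eq_self]
  rcases mem_iInter₂.1 (h j).1.2 t ht with h1 | h1
  · rcases mem_iInter₂.1 (h j).2.2 t ht with h2 | h2
    · have htu : t = u j := le_antisymm h2 h1
      rw [htu, Function.update_eq_self]
    · exact h2.2
  · exact h1.2

end Box

/-! ### Continuity and concavity of the worst-case expected utility -/

namespace MiningNetwork

variable {J : ℕ} (N : MiningNetwork J)

theorem weight_pos {α : Fin J → ℝ} (hα : ∀ k, α k ∈ N.strategies) (k : Fin J) : 0 < α k :=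
  N.τ₀_pos.trans_le (hα k).1

theorem reward_nonneg : 0 ≤ N.Φ + N.ρ * N.Ψ :=
  add_nonneg N.Φ_nonneg (mul_nonneg N.ρ_nonneg N.Ψ_nonneg)

/-- The share is unchanged when all resources are scaled together, and the weighted total is at
least `τ₀` times the total resource, so the constant does not depend on `d`. -/
theorem abs_share_sub_le {j : Fin J} {α β d : Fin J → ℝ} (hα : ∀ k, α k ∈ N.strategies)
    (hβ : ∀ k, β k ∈ N.strategies) (hd : ∀ k, 0 < N.resource d k) :
    |N.share j α d - N.share j β d| ≤ 2 / N.τ₀ * dist α β := by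
  set x := N.resource d with hx
  set D := dist α β with hD
  have hD0 : 0 ≤ D := dist_nonneg
  have hτ := N.τ₀_pos
  have hab : ∀ k, |α k - β k| ≤ D := fun k => by
    rw [← Real.dist_eq]; exact dist_le_pi_dist α β k
  set X := ∑ k, x k with hX
  set A := ∑ k, α k * x k with hA
  set B := ∑ k, β k * x k with hB
  have hxX : x j ≤ X := Finset.single_le_sum (fun k _ => (hd k).le) (Finset.mem_univ j)
  have hX0 : 0 < X := (hd j).trans_le hxX
  have hAX : N.τ₀ * X ≤ A := by
    rw [hX, Finset.mul_sum]
    exact Finset.sum_le_sum fun k _ => mul_le_mul_of_nonneg_right (hα k).1 (hd k).le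
  have hA0 : 0 < A := (mul_pos hτ hX0).trans_le hAX
  have hBj : β j * x j ≤ B := Finset.single_le_sum (f := fun k => β k * x k)
    (fun k _ => mul_nonneg (N.weight_pos hβ k).le (hd k).le) (Finset.mem_univ j)
  have hbj : 0 < β j * x j := mul_pos (N.weight_pos hβ j) (hd j)
  have hB0 : 0 < B := hbj.trans_le hBj
  have hAB : |B - A| ≤ D * X := by
    rw [hA, hB, ← Finset.sum_sub_distrib, hX, Finset.mul_sum]
    refine (Finset.abs_sum_le_sum_abs _ _).trans (Finset.sum_le_sum fun k _ => ?_)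
    rw [← sub_mul, abs_mul, abs_of_pos (hd k), abs_sub_comm]
    exact mul_le_mul_of_nonneg_right (hab k) (hd k).le
  have hXA : X / A ≤ 1 / N.τ₀ := by
    rw [div_le_div_iff₀ hA0 hτ]
    linarith
  -- Change the numerator first, then the denominator; each change costs at most `dist α β / τ₀`.
  have hsplit : N.share j α d - N.share j β d =
      (α j - β j) * (x j / A) + β j * x j / B * ((B - A) / A) := by
    simp only [share, ← hx, ← hA, ← hB]
    field_simp
    ring
  have h1 : |(α j - β j) * (x j / A)| ≤ D * (1 / N.τ₀) := by
    rw [abs_mul, abs_of_pos (div_pos (hd j) hA0)]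
    refine mul_le_mul (hab j) (le_trans ?_ hXA) (div_pos (hd j) hA0).le hD0
    exact div_le_div_of_nonneg_right hxX hA0.le
  have h2 : |β j * x j / B * ((B - A) / A)| ≤ D * (1 / N.τ₀) := by
    rw [abs_mul, abs_div (B - A), abs_of_pos (div_pos hbj hB0), abs_of_pos hA0]
    refine (mul_le_of_le_one_left (by positivity) (div_le_one_of_le₀ hBj hB0.le)).trans ?_
    calc |B - A| / A ≤ D * X / A := div_le_div_of_nonneg_right hAB hA0.le
      _ = D * (X / A) := by ring
      _ ≤ D * (1 / N.τ₀) := mul_le_mul_of_nonneg_left hXA hD0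
  rw [hsplit]
  refine (abs_add_le _ _).trans ((add_le_add h1 h2).trans_eq ?_)
  ring

theorem abs_utility_sub_le {j : Fin J} {α β d : Fin J → ℝ} (hα : ∀ k, α k ∈ N.strategies)
    (hβ : ∀ k, β k ∈ N.strategies) (hd : ∀ k, 0 < N.resource d k) :
    |N.utility j α d - N.utility j β d| ≤
      ((N.Φ + N.ρ * N.Ψ) * (2 / N.τ₀) + N.c j * N.resource d j) * dist α β := by
  have hsplit : N.utility j α d - N.utility j β d =
      (N.Φ + N.ρ * N.Ψ) * (N.share j α d - N.share j β d) +
        N.c j * N.resource d j * (β j - α j) := by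
    simp only [utility]; ring
  have hj : |β j - α j| ≤ dist α β := by
    rw [abs_sub_comm, ← Real.dist_eq]; exact dist_le_pi_dist α β j
  have hc : 0 ≤ N.c j * N.resource d j := mul_nonneg (N.c_nonneg j) (hd j).le
  rw [hsplit, add_mul (_ * (2 / N.τ₀)), mul_assoc (N.Φ + N.ρ * N.Ψ) (2 / N.τ₀)]
  refine (abs_add_le _ _).trans (add_le_add ?_ ?_)
  · rw [abs_mul, abs_of_nonneg N.reward_nonneg]
    exact mul_le_mul_of_nonneg_left (N.abs_share_sub_le hα hβ hd) N.reward_nonneg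
  · rw [abs_mul, abs_of_nonneg hc]
    exact mul_le_mul_of_nonneg_left hj hc

/-- The pointwise bound is affine in the miner's own uncertainty, so its expectation depends on `P`
only through the mean, which is fixed over the ambiguity set. -/
theorem abs_expectedUtility_sub_le {Q : Measure (Fin J → ℝ)} (hQ : N.IsRivalLaw Q) {j : Fin J}
    {P : Measure ℝ} (hP : P ∈ N.ambiguitySet j) {α β : Fin J → ℝ}
    (hα : ∀ k, α k ∈ N.strategies) (hβ : ∀ k, β k ∈ N.strategies) :
    |N.expectedUtility Q j P α - N.expectedUtility Q j P β| ≤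
      ((N.Φ + N.ρ * N.Ψ) * (2 / N.τ₀) + N.c j * (N.xhat j + N.μ j)) * dist α β := by
  have := hQ.1
  have := hP.1
  have hid : Integrable (fun ξ : ℝ => ξ) P := hP.2.1.integrable one_le_two
  have hint : Integrable (fun z : (Fin J → ℝ) × ℝ => ((N.Φ + N.ρ * N.Ψ) * (2 / N.τ₀) +
      N.c j * (N.xhat j + z.2)) * dist α β) (Q.prod P) :=
    ((integrable_const _).add
      (((integrable_const _).add (hid.comp_snd Q)).const_mul _)).mul_const _
  have hres : Integrable (fun ξ : ℝ => N.xhat j + ξ) P := (integrable_const _).add hid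
  have hval : ∫ z : (Fin J → ℝ) × ℝ, ((N.Φ + N.ρ * N.Ψ) * (2 / N.τ₀) +
      N.c j * (N.xhat j + z.2)) * dist α β ∂(Q.prod P) =
      ((N.Φ + N.ρ * N.Ψ) * (2 / N.τ₀) + N.c j * (N.xhat j + N.μ j)) * dist α β := by
    rw [integral_fun_snd (μ := Q) (fun ξ : ℝ => ((N.Φ + N.ρ * N.Ψ) * (2 / N.τ₀) +
      N.c j * (N.xhat j + ξ)) * dist α β), integral_mul_const,
      integral_add (integrable_const _) (hres.const_mul _), integral_const_mul (N.c j), integral_add (integrable_const _) hid, hP.2.2.2.1]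
    simp
  unfold expectedUtility
  rw [← integral_sub (N.integrable_utility hQ hP hα) (N.integrable_utility hQ hP hβ), ← hval,
    ← Real.norm_eq_abs]
  refine norm_integral_le_of_norm_le hint ?_
  filter_upwards [N.ae_resource_pos hQ hP] with z hz
  have := N.abs_utility_sub_le (j := j) hα hβ hz
  rwa [show N.resource (Function.update z.1 j z.2) j = N.xhat j + z.2 by simp [resource]] at this

theorem robustUtility_le_add {Q : Measure (Fin J → ℝ)} (hQ : N.IsRivalLaw Q) (j : Fin J)
    {α β : Fin J → ℝ} (hα : ∀ k, α k ∈ N.strategies) (hβ : ∀ k, β k ∈ N.strategies) :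
    N.robustUtility Q j α ≤ N.robustUtility Q j β +
      ((N.Φ + N.ρ * N.Ψ) * (2 / N.τ₀) + N.c j * (N.xhat j + N.μ j)) * dist α β := by
  have := (N.ambiguitySet_nonempty j).to_subtype
  rw [← sub_le_iff_le_add]
  refine le_ciInf fun P => ?_
  have h1 := ciInf_le (N.bddBelow_expectedUtility hQ j hα) P
  have h2 := (abs_le.1 (N.abs_expectedUtility_sub_le hQ P.2 hα hβ)).2
  unfold robustUtility
  linarith

theorem continuousOn_robustUtility {Q : Measure (Fin J → ℝ)} (hQ : N.IsRivalLaw Q) (j : Fin J) :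
    ContinuousOn (N.robustUtility Q j) (Set.pi univ fun _ => Icc N.τ₀ 1) := by
  have hC : 0 ≤ (N.Φ + N.ρ * N.Ψ) * (2 / N.τ₀) + N.c j * (N.xhat j + N.μ j) :=
    add_nonneg (mul_nonneg N.reward_nonneg (div_nonneg zero_le_two N.τ₀_pos.le))
      (mul_nonneg (N.c_nonneg j) (N.mean_pos j).le)
  refine (LipschitzOnWith.of_le_add_mul (Real.toNNReal ((N.Φ + N.ρ * N.Ψ) * (2 / N.τ₀) +
    N.c j * (N.xhat j + N.μ j))) fun α hα β hβ => ?_).continuousOn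
  rw [Real.coe_toNNReal _ hC]
  exact N.robustUtility_le_add hQ j (mem_univ_pi.1 hα) (mem_univ_pi.1 hβ)

theorem update_mem_strategies {α : Fin J → ℝ} (hα : ∀ k, α k ∈ N.strategies) (j : Fin J) {t : ℝ}
    (ht : t ∈ N.strategies) (k : Fin J) : Function.update α j t k ∈ N.strategies := by
  by_cases hk : k = j
  · subst hk; simpa using ht
  · simpa [Function.update_of_ne hk] using hα k

/-- The function is `1 - y / (t * x + y)`; the proof writes the concavity gap as an explicit
nonnegative fraction. -/
theorem concaveOn_mul_div_mul_add {x y : ℝ} (hx : 0 < x) (hy : 0 ≤ y) :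
    ConcaveOn ℝ (Ioi 0) fun t : ℝ => t * x / (t * x + y) := by
  refine ⟨convex_Ioi 0, fun s hs t ht p q hp hq hpq => ?_⟩
  rw [mem_Ioi] at hs ht
  have hst : 0 < p * s + q * t := (convex_Ioi (0 : ℝ)) hs ht hp hq hpq
  simp only [smul_eq_mul]
  have hS : 0 < s * x + y := by positivity
  have hT : 0 < t * x + y := by positivity
  have hM : 0 < (p * s + q * t) * x + y := by positivity
  obtain rfl : q = 1 - p := by linarith
  have key : (p * s + (1 - p) * t) * x / ((p * s + (1 - p) * t) * x + y) -
      (p * (s * x / (s * x + y)) + (1 - p) * (t * x / (t * x + y))) =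
      p * (1 - p) * y * (x * (s - t)) ^ 2 /
        (((p * s + (1 - p) * t) * x + y) * (s * x + y) * (t * x + y)) := by
    field_simp
    ring
  rw [← sub_nonneg, key]
  positivity

theorem concaveOn_utility {j : Fin J} {α d : Fin J → ℝ} (hα : ∀ k, α k ∈ N.strategies)
    (hd : ∀ k, 0 < N.resource d k) :
    ConcaveOn ℝ N.strategies fun t => N.utility j (Function.update α j t) d := by
  have hy : 0 ≤ ∑ k ∈ Finset.univ.erase j, α k * N.resource d k :=
    Finset.sum_nonneg fun k _ => mul_nonneg (N.weight_pos hα k).le (hd k).le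
  have hsub : N.strategies ⊆ Ioi 0 := fun t ht => N.τ₀_pos.trans_le ht.1
  have hconv : Convex ℝ N.strategies := convex_Icc _ _
  have hshare := ((concaveOn_mul_div_mul_add (hd j) hy).subset hsub hconv).smul N.reward_nonneg
  have hcost : ConcaveOn ℝ N.strategies fun t : ℝ => -(N.c j * N.resource d j) * t :=
    (LinearMap.mulLeft ℝ (-(N.c j * N.resource d j))).concaveOn hconv
  refine (hshare.add hcost).congr fun t _ => ?_
  have hsum : ∑ k, Function.update α j t k * N.resource d k =
      t * N.resource d j + ∑ k ∈ Finset.univ.erase j, α k * N.resource d k := by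
    rw [← Finset.add_sum_erase _ _ (Finset.mem_univ j), Function.update_self]
    congr 1
    refine Finset.sum_congr rfl fun k hk => ?_
    rw [Function.update_of_ne (Finset.ne_of_mem_erase hk)]
  simp only [Pi.add_apply, utility, share, hsum, Function.update_self, smul_eq_mul]
  ring

theorem concaveOn_expectedUtility {Q : Measure (Fin J → ℝ)} (hQ : N.IsRivalLaw Q) {j : Fin J}
    {P : Measure ℝ} (hP : P ∈ N.ambiguitySet j) {α : Fin J → ℝ} (hα : ∀ k, α k ∈ N.strategies) :
    ConcaveOn ℝ N.strategies fun t => N.expectedUtility Q j P (Function.update α j t) := by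
  have hconv : Convex ℝ N.strategies := convex_Icc _ _
  refine ⟨hconv, fun s hs t ht p q hp hq hpq => ?_⟩
  have hI : ∀ r ∈ N.strategies, Integrable (fun z : (Fin J → ℝ) × ℝ =>
      N.utility j (Function.update α j r) (Function.update z.1 j z.2)) (Q.prod P) :=
    fun r hr => N.integrable_utility hQ hP (N.update_mem_strategies hα j hr)
  simp only [smul_eq_mul, expectedUtility]
  rw [← integral_const_mul, ← integral_const_mul,
    ← integral_add ((hI s hs).const_mul p) ((hI t ht).const_mul q)]
  refine integral_mono_ae (((hI s hs).const_mul p).add ((hI t ht).const_mul q))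
    (hI _ (hconv hs ht hp hq hpq)) ?_
  filter_upwards [N.ae_resource_pos hQ hP] with z hz
  exact (N.concaveOn_utility hα hz).2 hs ht hp hq hpq

/-- A pointwise infimum of concave functions is concave; `bddBelow_expectedUtility` makes the real
infimum a genuine lower bound. -/
theorem concaveOn_robustUtility {Q : Measure (Fin J → ℝ)} (hQ : N.IsRivalLaw Q) (j : Fin J)
    {α : Fin J → ℝ} (hα : ∀ k, α k ∈ N.strategies) :
    ConcaveOn ℝ N.strategies fun t => N.robustUtility Q j (Function.update α j t) := by
  have := (N.ambiguitySet_nonempty j).to_subtype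
  refine ⟨convex_Icc _ _, fun s hs t ht p q hp hq hpq => le_ciInf fun P => ?_⟩
  refine le_trans ?_ ((N.concaveOn_expectedUtility hQ P.2 hα).2 hs ht hp hq hpq)
  have hle : ∀ r ∈ N.strategies, N.robustUtility Q j (Function.update α j r) ≤
      N.expectedUtility Q j P (Function.update α j r) := fun r hr =>
    ciInf_le (N.bddBelow_expectedUtility hQ j (N.update_mem_strategies hα j hr)) P
  exact add_le_add (smul_le_smul_of_nonneg_left (hle s hs) hp)
    (smul_le_smul_of_nonneg_left (hle t ht) hq)

end MiningNetwork

theorem theorem1 {J : ℕ} (N : MiningNetwork J) (Q : Measure (Fin J → ℝ)) (hQ : N.IsRivalLaw Q) :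
    ∃ α : Fin J → ℝ, N.IsRobustNashEquilibrium Q α :=
  exists_nash_equilibrium_of_quasiconcaveOn N.τ₀_le_one (N.robustUtility Q)
    (N.continuousOn_robustUtility hQ)
    fun j _ hα => (N.concaveOn_robustUtility hQ j hα).quasiconcaveOn
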